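/- Let $n$ be a nonnegative integer (for $n=0$ empty sums are $0$ and empty products are $1$) and let $q\in\mathbb C$ with $0<|q|<1$. Write $(z)_k=\prod_{j=0}^{k-1}(1-zq^j)$, $(z)_\infty=\prod_{j\ge 0}(1-zq^j)$, and $(u,v)_\infty=(u)_\infty(v)_\infty$. For $\boldsymbol k=(k_1,\dots,k_n)\in\mathbb Z_{\ge0}^n$ put $|\boldsymbol k|=k_1+\cdots+k_n$. Let $\alpha,b,x_1,\dots,x_n\in\mathbb C$ with all $x_r\ne0$, and suppose that $x_rq^j\ne x_s$ for $r\neq s$ and $j\ge0$, that $\alpha x_r\ne1$ for all $r$, and that $\alpha b x_rq^j\neq1$ for all $r$ and $j\ge0$ (so that the denominators below which do not involve the $a_r$ do not vanish). For $a=(a_1,\dots,a_n)\in\mathbb C^n$ and a family $F=(F(\boldsymbol m))_{\boldsymbol m\in\mathbb Z_{\ge0}^n}$ of complex numbers put $$P(a)=\prod_{r=1}^n\frac{(\alpha qx_r,\ \alpha a_rbx_r/q)_\infty}{(\alpha bx_r,\ \alpha a_rx_r)_\infty},$$ $$\begin{aligned}T_F(a;\boldsymbol k)={}&\prod_{1\le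 r<s\le n}\frac{1-q^{k_r-k_s}x_r/x_s}{1-x_r/x_s}\prod_{r,s=1}^n\frac{(qx_r/(x_sa_s))_{k_r}}{(qx_r/x_s)_{k_r}}\prod_{r=1}^n\frac{1-\alpha x_rq^{k_r+|\boldsymbol k|}}{1-\alpha x_r}\prod_{r=1}^n\frac{(\alpha x_r)_{|\boldsymbol k|}}{(\alpha x_ra_r)_{|\boldsymbol k|}}\\&\times(a_1\cdots a_n)^{|\boldsymbol k|}q^{\sum_{r=1}^n(r-1)k_r-n|\boldsymbol k|}\sum_{\substack{0\le m_r\le k_r\\ r=1,\dots,n}}\ \prod_{1\le r<s\le n}\frac{1-q^{m_r-m_s}x_r/x_s}{1-x_r/x_s}\prod_{r,s=1}^n\frac{(q^{-k_s}x_r/x_s)_{m_r}}{(qx_r/x_s)_{m_r}}\\&\times\prod_{r=1}^n\frac{(\alpha x_rq^{|\boldsymbol k|})_{m_r}}{(\alpha bx_r)_{m_r}}\ q^{\sum_{r=1}^nrm_r}F(\boldsymbol m).\end{aligned}$$ The products $(qx_r/(x_sa_s))_{k_r}\,a_s^{k_r}=\prod_{j=0}^{k_r-1}(a_s-q^{j+1}x_r/x_s)$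 are polynomials in $a_s$, and $T_F(a;\boldsymbol k)$ is understood accordingly when some $a_s=0$. **(1)** Let $f:\mathbb C\to\mathbb C$ be a function. Consider the identity $$f(\alpha a_1\cdots a_nq^{1-n})\,P(a)=\sum_{\boldsymbol k\in\mathbb Z_{\ge0}^n}T_F(a;\boldsymbol k),\qquad F(\boldsymbol m)=f(\alpha q^{1+|\boldsymbol m|}).$$ (a) Let $D=\{a:|a_r|<R_r,\ r=1,\dots,n\}$ with $R_1,\dots,R_n>0$ be a polydisc on which the denominators involving the $a_r$ do not vanish, i.e. $\alpha a_rx_rq^j\ne1$ for all $a\in D$, all $r$ and all $j\ge0$. If the left side is analytic in $a$ on $D$, and the series on the right converges absolutely at every point of $D$ with sum analytic in $a$ on $D$, then the identity holds for all $a\in D$. (b) If $a_r=q^{N_r}$ with positive integers $N_r$ for $r=1,\dots,n$, and $\alpha a_rx_rq^j\ne1$ for all $r$ and all $j\geq0$, then the series terminates, namely $T_F(a;\boldsymbol k)=0$ as soon as $k_r\ge N_r$ for some $r$, and the identity holds. **(2)** Let $f:\mathbb C^n\to\mathbb C$ be a function of $n$ variables. Then (a) and (b) hold likewise for the identity $$f(\alpha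 a_1,\dots,\alpha a_n)\,P(a)=\sum_{\boldsymbol k\in\mathbb Z_{\ge0}^n}T_F(a;\boldsymbol k),\qquad F(\boldsymbol m)=f(\alpha q^{1+m_1},\dots,\alpha q^{1+m_n}).$$ -/

import Mathlib

open Finset

noncomputable section

/-- The finite `q`-shifted factorial `(z; q)_k = ∏_{j < k} (1 - z q^j)`. -/
def qPoch (q z : ℂ) (k : ℕ) : ℂ := ∏ j ∈ range k, (1 - z * q ^ j)

/-- The infinite `q`-shifted factorial `(z; q)_∞ = ∏_{j ≥ 0} (1 - z q^j)`. -/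
def qPochInf (q z : ℂ) : ℂ := ∏' j : ℕ, (1 - z * q ^ j)

/-- The homogeneous `q`-shifted factorial `∏_{j < k} (a - c q^j)`, which is a polynomial in `a`
and equals `(c / a; q)_k a^k` for `a ≠ 0`. -/
def qPochHom (q a c : ℂ) (k : ℕ) : ℂ := ∏ j ∈ range k, (a - c * q ^ j)

/-- The `A_n` factor `∏_{r < s} (1 - q^{k_r - k_s} x_r / x_s) / (1 - x_r / x_s)`. -/
def anFactor {n : ℕ} (q : ℂ) (x : Fin n → ℂ) (k : Fin n → ℕ) : ℂ :=
  ∏ r, ∏ s ∈ Ioi r, (1 - q ^ ((k r : ℤ) - (k s : ℤ)) * x r / x s) / (1 - x r / x s)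

/-- The infinite-product factor
`∏_r (α q x_r, α a_r b x_r / q)_∞ / (α b x_r, α a_r x_r)_∞`. -/
def infFactor {n : ℕ} (q α b : ℂ) (x a : Fin n → ℂ) : ℂ :=
  ∏ r, (qPochInf q (α * q * x r) * qPochInf q (α * a r * b * x r / q)) /
    (qPochInf q (α * b * x r) * qPochInf q (α * a r * x r))

/-- The inner sum, over all `m` with `0 ≤ m_r ≤ k_r`; here `F m` stands for the value of the
expanded function attached to `m`. The index `r : Fin n` is counted from `0`, so the weight
`q ^ (∑ r m_r)` with `r = 1, …, n` has exponent `∑ (r + 1) m_r`. -/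
def innerSum {n : ℕ} (q α b : ℂ) (x : Fin n → ℂ) (F : (Fin n → ℕ) → ℂ) (k : Fin n → ℕ) : ℂ :=
  ∑ m ∈ Finset.Iic k,
    anFactor q x m *
    (∏ r, ∏ s, qPoch q (q ^ (-(k s : ℤ)) * x r / x s) (m r) / qPoch q (q * x r / x s) (m r)) *
    (∏ r, qPoch q (α * x r * q ^ (∑ i, k i)) (m r) / qPoch q (α * b * x r) (m r)) *
    q ^ (∑ r : Fin n, ((r : ℕ) + 1) * m r) * F m

/-- The `k`-th term of the outer series (meaningful when all `a_r` are nonzero). -/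
def outerTerm {n : ℕ} (q α b : ℂ) (x a : Fin n → ℂ) (F : (Fin n → ℕ) → ℂ) (k : Fin n → ℕ) : ℂ :=
  anFactor q x k *
  (∏ r, ∏ s, qPoch q (q * x r / (x s * a s)) (k r) / qPoch q (q * x r / x s) (k r)) *
  (∏ r, (1 - α * x r * q ^ (k r + ∑ i, k i)) / (1 - α * x r)) *
  (∏ r, qPoch q (α * x r) (∑ i, k i) / qPoch q (α * x r * a r) (∑ i, k i)) *
  (∏ r, a r) ^ (∑ i, k i) *
  q ^ ((∑ r : Fin n, ((r : ℕ) : ℤ) * (k r : ℤ)) - (n : ℤ) * (∑ i, (k i : ℤ))) *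
  innerSum q α b x F k

/-- The `k`-th term of the outer series as a function of `a` near the origin: the powers of the
`a_s` in `(a_1 ⋯ a_n)^{|k|}` are absorbed into the factors `(q x_r / (x_s a_s))_{k_r}`, which
removes the removable singularity on the hyperplanes `a_s = 0`. -/
def outerTermExt {n : ℕ} (q α b : ℂ) (x a : Fin n → ℂ) (F : (Fin n → ℕ) → ℂ)
    (k : Fin n → ℕ) : ℂ :=
  anFactor q x k *
  (∏ r, ∏ s, qPochHom q (a s) (q * x r / x s) (k r) / qPoch q (q * x r / x s) (k r)) *
  (∏ r, (1 - α * x r * q ^ (k r + ∑ i, k i)) / (1 - α * x r)) *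
  (∏ r, qPoch q (α * x r) (∑ i, k i) / qPoch q (α * x r * a r) (∑ i, k i)) *
  q ^ ((∑ r : Fin n, ((r : ℕ) : ℤ) * (k r : ℤ)) - (n : ℤ) * (∑ i, (k i : ℤ))) *
  innerSum q α b x F k

theorem qPochHom_eq (q a c : ℂ) (k : ℕ) (ha : a ≠ 0) :
    qPochHom q a c k = qPoch q (c / a) k * a ^ k := by
  unfold qPochHom qPoch
  rw [← Finset.card_range k, ← Finset.prod_const, Finset.card_range, ← Finset.prod_mul_distrib]
  refine Finset.prod_congr rfl fun j _ => ?_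
  field_simp

/-- For nonzero `a_r` the two forms of the term agree. -/
theorem outerTermExt_eq_outerTerm {n : ℕ} (q α b : ℂ) (x a : Fin n → ℂ)
    (F : (Fin n → ℕ) → ℂ) (k : Fin n → ℕ) (ha : ∀ r, a r ≠ 0) :
    outerTermExt q α b x a F k = outerTerm q α b x a F k := by
  have key : (∏ r, ∏ s, qPochHom q (a s) (q * x r / x s) (k r) / qPoch q (q * x r / x s) (k r))
      = (∏ r, ∏ s, qPoch q (q * x r / (x s * a s)) (k r) / qPoch q (q * x r / x s) (k r)) *
        (∏ r, a r) ^ (∑ i, k i) := by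
    rw [← Finset.prod_pow_eq_pow_sum, ← Finset.prod_mul_distrib]
    refine Finset.prod_congr rfl fun r _ => ?_
    rw [← Finset.prod_pow, ← Finset.prod_mul_distrib]
    refine Finset.prod_congr rfl fun s _ => ?_
    rw [qPochHom_eq _ _ _ _ (ha s), div_div]
    ring
  unfold outerTermExt outerTerm
  rw [key]
  ring

/-- The open polydisc about the origin with radii `R_1, …, R_n`. -/
def polydisc {n : ℕ} (R : Fin n → ℝ) : Set (Fin n → ℂ) := {a | ∀ r, ‖a r‖ < R r}

/-- `G a` and the series `∑_k T a k` are analytic in `a` on `D`, and the series converges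
absolutely at every point of `D`. -/
def BothSidesAnalytic {n : ℕ} (D : Set (Fin n → ℂ)) (G : (Fin n → ℂ) → ℂ)
    (T : (Fin n → ℂ) → (Fin n → ℕ) → ℂ) : Prop :=
  AnalyticOnNhd ℂ G D ∧ (∀ a ∈ D, Summable fun k => ‖T a k‖) ∧
    AnalyticOnNhd ℂ (fun a => ∑' k, T a k) D

end

/-! At `a_r = q^(M_r + 1)` the series is a product of two lower triangular matrices applied to a
vector: `outerCoeff`, indexed by `(M, k)`, times `innerCoeff`, indexed by `(k, m)`, applied to `F m
/ ∏ r, (α b x_r)_{m_r}`. The statement at these points says that the two matrices are inverse to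
each other up to the row factor `∏ r, (α q x_r)_{M_r}`; this factor and the denominator at `m = M`
together give the infinite products.

The inversion is proved in the order inner times outer, where the sum over `m` is an interpolation
sum. The nodes are `x_r q^j` with `j ≤ K_r`. Multiplied by powers of `q`, the `A_n` factor is a
Vandermonde product in the nodes `x_r q^(m_r)`, the inner Pochhammer quotients are Lagrange weights
(`nodeProd_mul_weight`), and what remains is a polynomial of degree less than `|K|` at each node.
The sum is therefore a determinant whose rows add up to zero, since a top divided difference
annihilates polynomials of low degree. The diagonal entries are computed directly
(`outerCoeff_mul_innerCoeff_self`). As the matrices over a box are finite, the one-sided inverse is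
two-sided.

This needs `α x_r q^j ≠ 1` for all `j`; continuity in `α` removes the excess. Finally the points
`q^(M_r + 1)` accumulate at the origin, and the identity theorem, applied one variable at a time,
extends the identity to the polydisc. -/

noncomputable section

/-! ### Divided differences and Vandermonde sums -/

section Interpolation

open Polynomial

/-- The sum is the coefficient of `X^(#s - 1)` in the Lagrange interpolant, which is `p` itself. -/
theorem sum_eval_div_prod_sub_eq_zero {ι : Type*} [DecidableEq ι] {s : Finset ι} {v : ι → ℂ}
    (hv : Set.InjOn v s) {p : ℂ[X]} (hp : p.natDegree + 1 < #s) :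
    ∑ i ∈ s, p.eval (v i) / ∏ j ∈ s.erase i, (v i - v j) = 0 := by
  rw [← Lagrange.coeff_eq_sum hv
    (lt_of_le_of_lt degree_le_natDegree (by exact_mod_cast (by lia : p.natDegree < #s)))]
  exact coeff_eq_zero_of_natDegree_lt (by lia)

/-- A sum over a box of a Vandermonde product times a product weight is a determinant. -/
theorem sum_Iic_vandermonde_mul_prod {n : ℕ} (K : Fin n → ℕ) (y w : Fin n → ℕ → ℂ) :
    ∑ m ∈ Iic K, (∏ r, ∏ s ∈ Ioi r, (y s (m s) - y r (m r))) * ∏ r, w r (m r) =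
      (Matrix.of fun (r i : Fin n) => ∑ j ∈ Iic (K r), w r j * y r j ^ (i : ℕ)).det := by
  have h := (Matrix.detRowAlternating (R := ℂ) (n := Fin n)).toMultilinearMap.map_sum_finset
    (fun r j => (fun i : Fin n => w r j * y r j ^ (i : ℕ))) (fun r => Iic (K r))
  have e : (Matrix.of fun (r i : Fin n) => ∑ j ∈ Iic (K r), w r j * y r j ^ (i : ℕ)) =
      fun r => ∑ j ∈ Iic (K r), (fun i : Fin n => w r j * y r j ^ (i : ℕ)) := by
    ext r i
    simp
  rw [e]
  refine Eq.trans ?_ h.symm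
  refine Finset.sum_congr ?_ fun m _ => ?_
  · ext m
    simp [Fintype.mem_piFinset, Pi.le_def]
  · rw [← Matrix.det_vandermonde, mul_comm, ← Matrix.det_mul_column]
    rfl

/-- The vanishing of a Vandermonde-weighted sum of divided-difference type over a box. -/
theorem sum_Iic_vandermonde_mul_eval_div_eq_zero {n : ℕ} (K : Fin n → ℕ) (y : Fin n → ℕ → ℂ)
    (hy : Set.InjOn (fun t : (_ : Fin n) × ℕ => y t.1 t.2)
      (univ.sigma fun r => Iic (K r) : Finset ((_ : Fin n) × ℕ)))
    {p : ℂ[X]} (hp : p.natDegree < ∑ r, K r) :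
    ∑ m ∈ Iic K, (∏ r, ∏ s ∈ Ioi r, (y s (m s) - y r (m r))) *
      ∏ r, (p.eval (y r (m r)) / ∏ t ∈ (univ.sigma fun r => Iic (K r)).erase ⟨r, m r⟩,
        (y r (m r) - y t.1 t.2)) = 0 := by
  rw [sum_Iic_vandermonde_mul_prod K y fun r j =>
    p.eval (y r j) / ∏ t ∈ (univ.sigma fun r => Iic (K r)).erase ⟨r, j⟩, (y r j - y t.1 t.2)]
  have hn : Nonempty (Fin n) := by
    by_contra h
    rw [not_nonempty_iff] at h
    simp at hp
  rw [← Matrix.exists_vecMul_eq_zero_iff]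
  -- The rows add up to zero: the sum of column `i` is the top divided difference of `p * X^i` over
  -- the whole grid. The grid has `|K| + n` nodes and the degree is at most `(|K| - 1) + (n - 1)`,
  -- just below the threshold.
  refine ⟨1, one_ne_zero, ?_⟩
  ext i
  simp only [Matrix.vecMul, dotProduct, Pi.one_apply, one_mul, Matrix.of_apply, Pi.zero_apply]
  have hcard : #(univ.sigma fun r => Iic (K r) : Finset ((_ : Fin n) × ℕ)) = ∑ r, K r + n := by
    simp [Finset.sum_add_distrib]
  have h := sum_eval_div_prod_sub_eq_zero hy (p := p * X ^ (i : ℕ)) (by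
    have h1 := natDegree_mul_le (p := p) (q := X ^ (i : ℕ))
    rw [natDegree_X_pow] at h1
    have := i.2
    rw [hcard]
    lia)
  rw [Finset.sum_sigma] at h
  rw [← h]
  refine Finset.sum_congr rfl fun r _ => Finset.sum_congr rfl fun j _ => ?_
  simp
  ring

end Interpolation

/-! ### Finite and infinite q-shifted factorials -/

section Pochhammer

theorem qPoch_add (q z : ℂ) (k l : ℕ) :
    qPoch q z (k + l) = qPoch q z k * qPoch q (z * q ^ k) l := by
  unfold qPoch
  rw [prod_range_add]
  simp only [pow_add, mul_assoc]

theorem qPoch_succ' (q z : ℂ) (k : ℕ) : qPoch q z (k + 1) = (1 - z) * qPoch q (z * q) k := by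
  rw [add_comm, qPoch_add]
  simp [qPoch]

theorem qPoch_ne_zero {q z : ℂ} (h : ∀ j : ℕ, z * q ^ j ≠ 1) (k : ℕ) : qPoch q z k ≠ 0 :=
  prod_ne_zero_iff.2 fun j _ => sub_ne_zero.2 (h j).symm

theorem summable_norm_mul_pow {q : ℂ} (hq : ‖q‖ < 1) (z : ℂ) :
    Summable fun j : ℕ => ‖-(z * q ^ j)‖ := by
  simp only [norm_neg, norm_mul, norm_pow]
  exact (summable_geometric_of_lt_one (norm_nonneg q) hq).mul_left _

theorem qPochInf_eq_mul {q : ℂ} (hq : ‖q‖ < 1) (z : ℂ) (k : ℕ) :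
    qPochInf q z = qPoch q z k * qPochInf q (z * q ^ k) := by
  have h : Multipliable fun j : ℕ => 1 - z * q ^ (j + k) := by
    have := multipliable_one_add_of_summable (summable_norm_mul_pow hq (z * q ^ k))
    refine this.congr fun j => ?_
    ring
  have h2 := Multipliable.prod_mul_tprod_nat_mul' (f := fun j : ℕ => 1 - z * q ^ j) h
  unfold qPochInf qPoch
  rw [← h2]
  congr 1
  refine tprod_congr fun j => ?_
  ring

theorem qPochInf_ne_zero {q z : ℂ} (hq : ‖q‖ < 1) (h : ∀ j : ℕ, z * q ^ j ≠ 1) :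
    qPochInf q z ≠ 0 := by
  have := tprod_one_add_ne_zero_of_summable (f := fun j : ℕ => -(z * q ^ j))
    (fun j => by rw [← sub_eq_add_neg]; exact sub_ne_zero.2 (h j).symm)
    (summable_norm_mul_pow hq z)
  simpa only [qPochInf, sub_eq_add_neg] using this

/-- Telescoping of shifted factors. -/
theorem qPoch_mul_prod_shift {q : ℂ} (hq : q ≠ 0) (X : ℂ) (K m : ℕ) :
    qPoch q (q * X) m * ∏ j ∈ range (K + 1), (1 - q ^ (-(j : ℤ)) * X) =
      qPoch q (q ^ (-(K : ℤ)) * X) m * ∏ j ∈ range (K + 1), (1 - q ^ ((m : ℤ) - j) * X) := by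
  induction m with
  | zero => simp [qPoch]
  | succ m ih =>
    have e1 : ∏ j ∈ range (K + 1), (1 - q ^ (((m + 1 : ℕ) : ℤ) - j) * X) =
        (∏ j ∈ range K, (1 - q ^ ((m : ℤ) - j) * X)) * (1 - q ^ ((m : ℤ) + 1) * X) := by
      rw [prod_range_succ']
      congr 1
      · refine prod_congr rfl fun j _ => ?_
        push_cast
        congr 3
        ring
    have s1 : ∀ z : ℂ, qPoch q z (m + 1) = qPoch q z m * (1 - z * q ^ m) := fun z => by
      simp [qPoch, prod_range_succ]
    rw [prod_range_succ (fun j : ℕ => 1 - q ^ ((m : ℤ) - j) * X)] at ih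
    have e2 : q ^ ((m : ℤ) + 1) * X = q * X * q ^ m := by
      rw [zpow_add_one₀ hq, zpow_natCast]; ring
    have e3 : q ^ (-(K : ℤ)) * X * q ^ m = q ^ ((m : ℤ) - K) * X := by
      rw [sub_eq_add_neg, zpow_add₀ hq, zpow_natCast]; ring
    rw [s1, s1, e1, e3, e2]
    linear_combination (1 - q * X * q ^ m) * ih

end Pochhammer

/-! ### The grid of nodes `x_r q^j` and the `A_n` factors -/

section Nodes

variable {n : ℕ} {q : ℂ} {x : Fin n → ℂ}

theorem qpow_injective (hq0 : 0 < ‖q‖) (hq1 : ‖q‖ < 1) :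
    Function.Injective fun j : ℕ => q ^ j := by
  intro i j h
  have h' : ‖q‖ ^ i = ‖q‖ ^ j := by simpa using congrArg norm h
  exact (pow_right_injective₀ hq0 hq1.ne) h'

theorem injective_node (hq0 : 0 < ‖q‖) (hq1 : ‖q‖ < 1) (hx0 : ∀ r, x r ≠ 0)
    (hx : ∀ r s, r ≠ s → ∀ j : ℕ, x r * q ^ j ≠ x s) :
    Function.Injective fun t : (_ : Fin n) × ℕ => x t.1 * q ^ t.2 := by
  have hq : q ≠ 0 := norm_pos_iff.1 hq0
  have key : ∀ r s : Fin n, ∀ i j : ℕ, j ≤ i → x r * q ^ i = x s * q ^ j → r = s := by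
    intro r s i j hij h
    by_contra hrs
    obtain ⟨d, rfl⟩ := Nat.exists_eq_add_of_le hij
    apply hx r s hrs d
    apply mul_right_cancel₀ (pow_ne_zero j hq)
    rw [← h, pow_add]
    ring
  rintro ⟨r, i⟩ ⟨s, j⟩ h
  simp only at h
  have hrs : r = s := by
    rcases le_total j i with hij | hij
    · exact key r s i j hij h
    · exact (key s r j i hij h.symm).symm
  subst hrs
  have := qpow_injective hq0 hq1 (mul_left_cancel₀ (hx0 r) h)
  rw [this]

theorem one_sub_zpow_mul_div_ne_zero (hq0 : 0 < ‖q‖) (hx0 : ∀ r, x r ≠ 0)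
    (hx : ∀ r s, r ≠ s → ∀ j : ℕ, x r * q ^ j ≠ x s) {r s : Fin n} (hrs : r ≠ s) (i : ℤ) :
    1 - q ^ i * (x r / x s) ≠ 0 := by
  have hq : q ≠ 0 := norm_pos_iff.1 hq0
  intro h
  have h1 : q ^ i * x r = x s := by
    have := hx0 s
    field_simp at h
    linear_combination -h
  obtain ⟨j, rfl | rfl⟩ := i.eq_nat_or_neg
  · exact hx r s hrs j (by rw [← h1, zpow_natCast]; ring)
  · refine hx s r hrs.symm j ?_
    rw [← h1, zpow_neg, zpow_natCast]
    field_simp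

theorem one_sub_div_ne_zero (hq0 : 0 < ‖q‖) (hx0 : ∀ r, x r ≠ 0)
    (hx : ∀ r s, r ≠ s → ∀ j : ℕ, x r * q ^ j ≠ x s) {r s : Fin n} (hrs : r ≠ s) :
    1 - x r / x s ≠ 0 := by
  simpa using one_sub_zpow_mul_div_ne_zero hq0 hx0 hx hrs 0

theorem qPoch_mul_div_ne_zero (hq0 : 0 < ‖q‖) (hq1 : ‖q‖ < 1) (hx0 : ∀ r, x r ≠ 0)
    (hx : ∀ r s, r ≠ s → ∀ j : ℕ, x r * q ^ j ≠ x s) (r s : Fin n) (k : ℕ) :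
    qPoch q (q * x r / x s) k ≠ 0 := by
  refine qPoch_ne_zero (fun j h => ?_) k
  have h1 : x r * q ^ (j + 1) = x s * q ^ 0 := by
    have := hx0 s
    field_simp at h
    rw [pow_succ, pow_zero]
    linear_combination h
  have := injective_node hq0 hq1 hx0 hx (a₁ := ⟨r, j + 1⟩) (a₂ := ⟨s, 0⟩) h1
  simp at this

/-- The telescoping identity at `X = 1`, with the vanishing factors removed. -/
theorem qPoch_mul_prod_erase (hq : q ≠ 0) {K m : ℕ} (hm : m ≤ K) :
    qPoch q q m * ∏ j ∈ (range (K + 1)).erase 0, (1 - q ^ (-(j : ℤ))) =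
      qPoch q (q ^ (-(K : ℤ))) m * ∏ j ∈ (range (K + 1)).erase m, (1 - q ^ ((m : ℤ) - j)) := by
  have h : (fun X : ℂ => qPoch q (q * X) m *
        ∏ j ∈ (range (K + 1)).erase 0, (1 - q ^ (-(j : ℤ)) * X)) =
      fun X : ℂ => qPoch q (q ^ (-(K : ℤ)) * X) m *
        ∏ j ∈ (range (K + 1)).erase m, (1 - q ^ ((m : ℤ) - j) * X) := by
    -- Both products in `qPoch_mul_prod_shift` contain the factor `1 - X`; it cancels for `X ≠ 1`,
    -- and continuity covers `X = 1`.
    refine Continuous.ext_on (dense_compl_singleton (1 : ℂ)) ?_ ?_ ?_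
    · unfold qPoch; fun_prop
    · unfold qPoch; fun_prop
    · intro X hX
      have hX' : 1 - X ≠ 0 := sub_ne_zero.2 (Ne.symm hX)
      have h := qPoch_mul_prod_shift hq X K m
      rw [← mul_prod_erase (range (K + 1)) (fun j : ℕ => 1 - q ^ (-(j : ℤ)) * X)
          (mem_range.2 K.succ_pos),
        ← mul_prod_erase (range (K + 1)) (fun j : ℕ => 1 - q ^ ((m : ℤ) - j) * X)
          (mem_range.2 (Nat.lt_succ_of_le hm))] at h
      simp only [Nat.cast_zero, neg_zero, zpow_zero, one_mul, sub_self] at h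
      apply mul_left_cancel₀ hX'
      linear_combination h
  simpa using congrFun h 1

/-- The nodal product at `x_r q^m` over the grid `{x_s q^j : j ≤ K_s}`. -/
def nodeProd (q : ℂ) (x : Fin n → ℂ) (K : Fin n → ℕ) (r : Fin n) (m : ℕ) : ℂ :=
  ∏ t ∈ (univ.sigma fun r => Iic (K r) : Finset ((_ : Fin n) × ℕ)).erase ⟨r, m⟩,
    (x r * q ^ m - x t.1 * q ^ t.2)

theorem nodeProd_eq (K : Fin n → ℕ) (r : Fin n) {m : ℕ} (hm : m ≤ K r) :
    nodeProd q x K r m = (∏ j ∈ (range (K r + 1)).erase m, (x r * q ^ m - x r * q ^ j)) *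
      ∏ s ∈ univ.erase r, ∏ j ∈ range (K s + 1), (x r * q ^ m - x s * q ^ j) := by
  unfold nodeProd
  have e : (univ.sigma fun r => Iic (K r) : Finset ((_ : Fin n) × ℕ)).erase ⟨r, m⟩ =
      univ.sigma fun s => if s = r then (range (K r + 1)).erase m else range (K s + 1) := by
    ext ⟨s, j⟩
    by_cases h : s = r
    · subst h
      simp
    · simp [h]
  rw [e, prod_sigma, ← mul_prod_erase univ _ (mem_univ r), if_pos rfl]
  congr 1
  refine prod_congr rfl fun s hs => ?_
  rw [if_neg (ne_of_mem_erase hs)]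

/-- Identifies the inner summand's Pochhammer quotients with Lagrange weights: up to a constant
independent of `m` they are the reciprocal nodal products. Each `s ≠ r` is a telescoping product,
and `s = r` is its version with the zero factor removed. -/
theorem nodeProd_mul_weight (hq0 : 0 < ‖q‖) (hq1 : ‖q‖ < 1) (hx0 : ∀ r, x r ≠ 0)
    (hx : ∀ r s, r ≠ s → ∀ j : ℕ, x r * q ^ j ≠ x s) (K : Fin n → ℕ) (r : Fin n) {m : ℕ}
    (hm : m ≤ K r) :
    nodeProd q x K r m * (q ^ m * ∏ s, qPoch q (q ^ (-(K s : ℤ)) * x r / x s) m /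
      qPoch q (q * x r / x s) m) = nodeProd q x K r 0 := by
  have hq : q ≠ 0 := norm_pos_iff.1 hq0
  have hfac : ∀ (s : Fin n) (m j : ℕ), x r * q ^ m - x s * q ^ j =
      (-(x s * q ^ j)) * (1 - q ^ ((m : ℤ) - j) * (x r / x s)) := by
    intro s m j
    have := hx0 s
    rw [zpow_sub₀ hq, zpow_natCast, zpow_natCast]
    field_simp
    ring
  rw [nodeProd_eq K r hm, nodeProd_eq K r (Nat.zero_le _),
    ← mul_prod_erase univ (fun s => qPoch q (q ^ (-(K s : ℤ)) * x r / x s) m /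
      qPoch q (q * x r / x s) m) (mem_univ r)]
  have hoff : (∏ s ∈ univ.erase r, ∏ j ∈ range (K s + 1), (x r * q ^ m - x s * q ^ j)) *
      (∏ s ∈ univ.erase r, qPoch q (q ^ (-(K s : ℤ)) * x r / x s) m /
        qPoch q (q * x r / x s) m) =
      ∏ s ∈ univ.erase r, ∏ j ∈ range (K s + 1), (x r * q ^ 0 - x s * q ^ j) := by
    rw [← prod_mul_distrib]
    refine prod_congr rfl fun s _ => ?_
    have h := qPoch_mul_prod_shift hq (x r / x s) (K s) m
    have hne := qPoch_mul_div_ne_zero hq0 hq1 hx0 hx r s m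
    rw [← mul_div_assoc, ← mul_div_assoc] at h
    rw [← mul_div_assoc, div_eq_iff hne]
    simp only [hfac s]
    rw [prod_mul_distrib, prod_mul_distrib]
    simp only [Nat.cast_zero, zero_sub]
    linear_combination -(∏ j ∈ range (K s + 1), (-(x s * q ^ j))) * h
  have hon : (∏ j ∈ (range (K r + 1)).erase m, (x r * q ^ m - x r * q ^ j)) *
      (q ^ m * (qPoch q (q ^ (-(K r : ℤ)) * x r / x r) m / qPoch q (q * x r / x r) m)) =
      ∏ j ∈ (range (K r + 1)).erase 0, (x r * q ^ 0 - x r * q ^ j) := by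
    have h := qPoch_mul_prod_erase hq hm
    have hne := qPoch_mul_div_ne_zero hq0 hq1 hx0 hx r r m
    have hc : ∀ i ≤ K r, (∏ j ∈ (range (K r + 1)).erase i, (-(x r * q ^ j))) * (-(x r * q ^ i)) =
        ∏ j ∈ range (K r + 1), (-(x r * q ^ j)) := fun i hi =>
      prod_erase_mul _ _ (mem_range.2 (Nat.lt_succ_of_le hi))
    -- Omitting `j = m` instead of `j = 0` changes the product of the prefactors by `q^m`, which is
    -- where the weight `q^m` is absorbed.
    have h2 : (∏ j ∈ (range (K r + 1)).erase m, (-(x r * q ^ j))) * q ^ m =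
        ∏ j ∈ (range (K r + 1)).erase 0, (-(x r * q ^ j)) := by
      apply mul_right_cancel₀ (neg_ne_zero.2 (hx0 r))
      have a := hc m hm
      have b := hc 0 (Nat.zero_le _)
      rw [pow_zero, mul_one] at b
      linear_combination a - b
    rw [← mul_div_assoc, ← mul_div_assoc, div_eq_iff hne]
    simp only [hfac r]
    rw [prod_mul_distrib, prod_mul_distrib, ← h2]
    simp only [Nat.cast_zero, zero_sub, mul_div_assoc, div_self (hx0 r), mul_one]
    linear_combination -(∏ j ∈ (range (K r + 1)).erase m, (-(x r * q ^ j))) * q ^ m * h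
  rw [← hoff, ← hon]
  ring

theorem nodeProd_ne_zero (hq0 : 0 < ‖q‖) (hq1 : ‖q‖ < 1) (hx0 : ∀ r, x r ≠ 0)
    (hx : ∀ r s, r ≠ s → ∀ j : ℕ, x r * q ^ j ≠ x s) (K : Fin n → ℕ) (r : Fin n) (m : ℕ) :
    nodeProd q x K r m ≠ 0 := by
  refine prod_ne_zero_iff.2 fun t ht => sub_ne_zero.2 fun h => (ne_of_mem_erase ht) ?_
  exact (injective_node hq0 hq1 hx0 hx (a₁ := ⟨r, m⟩) (a₂ := t) h).symm

theorem prod_prod_Ioi_snd (f : Fin n → ℂ) :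
    ∏ r : Fin n, ∏ s ∈ Ioi r, f s = ∏ s : Fin n, f s ^ (s : ℕ) := by
  rw [prod_comm' (t' := univ) (s' := fun s => Iio s) (by simp)]
  simp

theorem prod_prod_eq_prod_Ioi_mul_prod_diag (g : Fin n → Fin n → ℂ) :
    ∏ r, ∏ s, g r s = (∏ r, ∏ s ∈ Ioi r, g s r * g r s) * ∏ r, g r r := by
  rw [prod_prod_Ioi_mul_eq_prod_prod_off_diag, ← prod_mul_distrib, prod_comm]
  refine prod_congr rfl fun r _ => ?_
  rw [mul_comm, ← prod_singleton (fun s => g s r) r, prod_mul_prod_compl]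

/-- The factor of a pair `r < s` times `q^(m_s)` is a quotient of differences of nodes, and a given
`s` is the larger index of exactly `s` pairs when counting from `0`. -/
theorem anFactor_mul_pow (hq0 : 0 < ‖q‖) (hx0 : ∀ r, x r ≠ 0)
    (hx : ∀ r s, r ≠ s → ∀ j : ℕ, x r * q ^ j ≠ x s) (m : Fin n → ℕ) :
    anFactor q x m * q ^ (∑ r : Fin n, (r : ℕ) * m r) =
      (∏ r, ∏ s ∈ Ioi r, (x s * q ^ m s - x r * q ^ m r)) /
        ∏ r, ∏ s ∈ Ioi r, (x s - x r) := by
  have hq : q ≠ 0 := norm_pos_iff.1 hq0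
  have e : q ^ (∑ r : Fin n, (r : ℕ) * m r) = ∏ r : Fin n, ∏ s ∈ Ioi r, q ^ m s := by
    rw [prod_prod_Ioi_snd, ← prod_pow_eq_pow_sum]
    refine prod_congr rfl fun r _ => ?_
    rw [← pow_mul, mul_comm]
  rw [e, anFactor, ← prod_mul_distrib, ← prod_div_distrib]
  refine prod_congr rfl fun r _ => ?_
  rw [← prod_mul_distrib, ← prod_div_distrib]
  refine prod_congr rfl fun s hs => ?_
  have hrs : r ≠ s := (mem_Ioi.1 hs).ne
  have h1 := one_sub_div_ne_zero hq0 hx0 hx hrs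
  have h2 : x s - x r ≠ 0 := fun h => h1 (by
    rw [sub_eq_zero] at h
    rw [← h, div_self (hx0 s), sub_self])
  have := hx0 s
  rw [zpow_sub₀ hq, zpow_natCast, zpow_natCast, div_mul_eq_mul_div, div_eq_div_iff h1 h2]
  field_simp

/-- Pairs the `(r, s)` and `(s, r)` factors with `X = x_r / x_s`. Extracting monomials turns the
factorials in `1 / X` into products in `X`, to which the telescoping identity applies. -/
theorem qPoch_pair (hq : q ≠ 0) {X : ℂ} (hX : X ≠ 0) (K m : ℕ) :
    qPoch q (q ^ (-(K : ℤ)) * X) m * qPoch q (q ^ (-(m : ℤ)) / X) K *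
      (1 - q ^ ((m : ℤ) - K) * X) * q ^ (K * (m + 1)) =
    (1 - X) * qPoch q (q * X) m * qPoch q (q / X) K := by
  have h := qPoch_mul_prod_shift hq X K m
  rw [prod_range_succ' (fun j : ℕ => 1 - q ^ (-(j : ℤ)) * X),
    prod_range_succ (fun j : ℕ => 1 - q ^ ((m : ℤ) - j) * X)] at h
  simp only [Nat.cast_zero, neg_zero, zpow_zero, one_mul] at h
  have e1 : qPoch q (q ^ (-(m : ℤ)) / X) K * q ^ (K * (m + 1)) =
      (∏ j ∈ range K, (-(q ^ (j + 1) / X))) * ∏ j ∈ range K, (1 - q ^ ((m : ℤ) - j) * X) := by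
    rw [pow_mul', ← card_range K, ← prod_const, card_range, qPoch, ← prod_mul_distrib,
      ← prod_mul_distrib]
    refine prod_congr rfl fun j _ => ?_
    rw [zpow_sub₀ hq, zpow_neg, zpow_natCast, zpow_natCast]
    field_simp
    ring
  have e2 : qPoch q (q / X) K =
      (∏ j ∈ range K, (-(q ^ (j + 1) / X))) *
        ∏ j ∈ range K, (1 - q ^ (-((j + 1 : ℕ) : ℤ)) * X) := by
    rw [qPoch, ← prod_mul_distrib]
    refine prod_congr rfl fun j _ => ?_
    rw [zpow_neg, zpow_natCast]
    field_simp
    ring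
  rw [e2]
  linear_combination (qPoch q (q ^ (-(K : ℤ)) * X) m * (1 - q ^ ((m : ℤ) - K) * X)) * e1 -
    (∏ j ∈ range K, (-(q ^ (j + 1) / X))) * h

/-- Squaring removes the sign `(-1)^K` and the exponent `K (K + 1) / 2` that come from reversing the
product. -/
theorem qPoch_neg_sq (hq : q ≠ 0) (K : ℕ) :
    qPoch q (q ^ (-(K : ℤ))) K ^ 2 * q ^ (K * K + K) = qPoch q q K ^ 2 := by
  have e : qPoch q (q ^ (-(K : ℤ))) K = (∏ j ∈ range K, (-(q ^ (j + 1))⁻¹)) * qPoch q q K := by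
    rw [qPoch, qPoch, ← prod_range_reflect, ← prod_mul_distrib]
    refine prod_congr rfl fun j hj => ?_
    rw [mem_range] at hj
    obtain ⟨d, rfl⟩ := Nat.exists_eq_add_of_lt hj
    have : j + d + 1 - 1 - j = d := by lia
    rw [this, zpow_neg, zpow_natCast]
    field_simp
    ring
  have e2 : ∀ K : ℕ, (∏ j ∈ range K, (-(q ^ (j + 1))⁻¹)) ^ 2 * q ^ (K * K + K) = 1 := by
    intro K
    induction K with
    | zero => simp
    | succ K ih =>
      rw [prod_range_succ, ← ih, mul_pow]
      have : (K + 1) * (K + 1) + (K + 1) = K * K + K + 2 * (K + 1) := by ring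
      rw [this, pow_add q (K * K + K), pow_mul' q 2]
      field_simp
  rw [e]
  linear_combination qPoch q q K ^ 2 * e2 K

/-- The square of the diagonal entry of the `A_n` part of the inverse pair. -/
theorem anFactor_mul_prod_sq (hq0 : 0 < ‖q‖) (hq1 : ‖q‖ < 1) (hx0 : ∀ r, x r ≠ 0)
    (hx : ∀ r s, r ≠ s → ∀ j : ℕ, x r * q ^ j ≠ x s) (K : Fin n → ℕ) :
    (anFactor q x K * ∏ r, ∏ s, qPoch q (q ^ (-(K s : ℤ)) * x r / x s) (K r) /
      qPoch q (q * x r / x s) (K r)) ^ 2 * q ^ ((∑ r, K r) * ∑ r, K r) *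
      q ^ (∑ r : Fin n, (2 * (r : ℕ) + 1) * K r) = 1 := by
  have hq : q ≠ 0 := norm_pos_iff.1 hq0
  have e1 : q ^ ((∑ r, K r) * ∑ r, K r) = ∏ r, ∏ s, q ^ (K r * K s) := by
    rw [sum_mul_sum, ← prod_pow_eq_pow_sum]
    refine prod_congr rfl fun r _ => ?_
    rw [prod_pow_eq_pow_sum]
  have e2 : q ^ (∑ r : Fin n, (2 * (r : ℕ) + 1) * K r) =
      (∏ r : Fin n, ∏ s ∈ Ioi r, q ^ (2 * K s)) * ∏ r, q ^ K r := by
    rw [prod_prod_Ioi_snd, ← prod_mul_distrib, ← prod_pow_eq_pow_sum]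
    refine prod_congr rfl fun r _ => ?_
    rw [← pow_mul, ← pow_add]
    congr 1
    ring
  set c : Fin n → Fin n → ℂ := fun r s => qPoch q (q ^ (-(K s : ℤ)) * x r / x s) (K r) /
    qPoch q (q * x r / x s) (K r) with hc
  have e3 : (anFactor q x K * ∏ r, ∏ s, c r s) ^ 2 * (∏ r, ∏ s, q ^ (K r * K s)) =
      (anFactor q x K) ^ 2 * ∏ r, ∏ s, (c r s ^ 2 * q ^ (K r * K s)) := by
    simp only [prod_mul_distrib, prod_pow]
    ring
  rw [e1, e2, e3, prod_prod_eq_prod_Ioi_mul_prod_diag, anFactor]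
  have hdiag : (∏ r, c r r ^ 2 * q ^ (K r * K r)) * ∏ r, q ^ K r = 1 := by
    rw [← prod_mul_distrib]
    refine prod_eq_one fun r _ => ?_
    have h := qPoch_neg_sq hq (K r)
    have hne := qPoch_mul_div_ne_zero hq0 hq1 hx0 hx r r (K r)
    simp only [hc, mul_div_assoc, div_self (hx0 r), mul_one] at hne ⊢
    rw [div_pow, mul_assoc, ← pow_add, div_mul_eq_mul_div, h, div_self (pow_ne_zero 2 hne)]
  have hoff : (∏ r, ∏ s ∈ Ioi r, (1 - q ^ ((K r : ℤ) - (K s : ℤ)) * x r / x s) / (1 - x r / x s))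
      ^ 2 * (∏ r, ∏ s ∈ Ioi r, c s r ^ 2 * q ^ (K s * K r) * (c r s ^ 2 * q ^ (K r * K s))) *
      ∏ r : Fin n, ∏ s ∈ Ioi r, q ^ (2 * K s) = 1 := by
    rw [← prod_pow, ← prod_mul_distrib, ← prod_mul_distrib]
    refine prod_eq_one fun r _ => ?_
    rw [← prod_pow, ← prod_mul_distrib, ← prod_mul_distrib]
    refine prod_eq_one fun s hs => ?_
    have hrs : r ≠ s := (mem_Ioi.1 hs).ne
    have h1 := one_sub_div_ne_zero hq0 hx0 hx hrs
    have n1 := qPoch_mul_div_ne_zero hq0 hq1 hx0 hx r s (K r)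
    have n2 := qPoch_mul_div_ne_zero hq0 hq1 hx0 hx s r (K s)
    have h := qPoch_pair hq (div_ne_zero (hx0 r) (hx0 s)) (K s) (K r)
    simp only [div_div_eq_mul_div, ← mul_div_assoc] at h
    -- Each off-diagonal pair contributes `1` even before squaring; the square is needed only for
    -- the signs on the diagonal.
    have h' : c r s * c s r * ((1 - q ^ ((K r : ℤ) - (K s : ℤ)) * x r / x s) / (1 - x r / x s)) *
        q ^ (K s * (K r + 1)) = 1 := by
      simp only [hc]
      rw [div_mul_div_comm, div_mul_div_comm, div_mul_eq_mul_div, h, div_eq_one_iff_eq]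
      · ring
      · exact mul_ne_zero (mul_ne_zero n1 n2) h1
    have hp : q ^ (K s * (K r + 1)) ^ 1 = q ^ (K s * K r) * q ^ K s := by
      rw [pow_one, mul_add, mul_one, pow_add]
    rw [pow_one] at hp
    rw [mul_comm (K r) (K s), mul_comm 2 (K s), pow_mul q (K s) 2]
    rw [hp] at h'
    calc _ = (c r s * c s r * ((1 - q ^ ((K r : ℤ) - (K s : ℤ)) * x r / x s) / (1 - x r / x s)) *
          (q ^ (K s * K r) * q ^ K s)) ^ 2 := by ring
      _ = 1 := by rw [h', one_pow]
  linear_combination (∏ r, c r r ^ 2 * q ^ (K r * K r)) * (∏ r, q ^ K r) * hoff + hdiag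

end Nodes

/-! ### The inverse pair of triangular matrices -/

section Inversion

variable {n : ℕ} {q α : ℂ} {x : Fin n → ℂ}

/-- The factor of `outerTermExt` in front of the inner sum. -/
def outerCoeff (q α : ℂ) (x a : Fin n → ℂ) (k : Fin n → ℕ) : ℂ :=
  anFactor q x k *
  (∏ r, ∏ s, qPochHom q (a s) (q * x r / x s) (k r) / qPoch q (q * x r / x s) (k r)) *
  (∏ r, (1 - α * x r * q ^ (k r + ∑ i, k i)) / (1 - α * x r)) *
  (∏ r, qPoch q (α * x r) (∑ i, k i) / qPoch q (α * x r * a r) (∑ i, k i)) *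
  q ^ ((∑ r : Fin n, ((r : ℕ) : ℤ) * (k r : ℤ)) - (n : ℤ) * (∑ i, (k i : ℤ)))

/-- The coefficient of the inner sum for `b = 0`. -/
def innerCoeff (q α : ℂ) (x : Fin n → ℂ) (k m : Fin n → ℕ) : ℂ :=
  anFactor q x m *
  (∏ r, ∏ s, qPoch q (q ^ (-(k s : ℤ)) * x r / x s) (m r) / qPoch q (q * x r / x s) (m r)) *
  (∏ r, qPoch q (α * x r * q ^ (∑ i, k i)) (m r)) *
  q ^ (∑ r : Fin n, ((r : ℕ) + 1) * m r)

theorem innerSum_eq (b : ℂ) (F : (Fin n → ℕ) → ℂ) (k : Fin n → ℕ) :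
    innerSum q α b x F k =
      ∑ m ∈ Iic k, innerCoeff q α x k m * (F m / ∏ r, qPoch q (α * b * x r) (m r)) := by
  refine Finset.sum_congr rfl fun m _ => ?_
  rw [innerCoeff, prod_div_distrib (f := fun r => qPoch q (α * x r * q ^ (∑ i, k i)) (m r))]
  ring

theorem qPochHom_pow_succ (hq : q ≠ 0) (X : ℂ) (M k : ℕ) :
    qPochHom q (q ^ (M + 1)) (q * X) k = qPoch q (q ^ (-(M : ℤ)) * X) k * q ^ ((M + 1) * k) := by
  rw [qPochHom_eq _ _ _ _ (pow_ne_zero _ hq), pow_mul]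
  congr 2
  rw [zpow_neg, zpow_natCast]
  field_simp
  ring

theorem qPoch_neg_eq_zero (hq : q ≠ 0) {M k : ℕ} (h : M < k) :
    qPoch q (q ^ (-(M : ℤ))) k = 0 := by
  refine prod_eq_zero (mem_range.2 h) ?_
  rw [zpow_neg, zpow_natCast, inv_mul_cancel₀ (pow_ne_zero _ hq), sub_self]

/-- Triangularity: the factor with `r = s` is a multiple of `(q^(-m_r))_{k_r}`, which vanishes for
`k_r > m_r`. This also makes the series terminate. -/
theorem outerCoeff_eq_zero (hq : q ≠ 0) (hx0 : ∀ r, x r ≠ 0) {k m : Fin n → ℕ} (h : ¬ k ≤ m) :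
    outerCoeff q α x (fun s => q ^ (m s + 1)) k = 0 := by
  rw [Pi.le_def] at h
  push Not at h
  obtain ⟨r, hr⟩ := h
  have : (∏ r, ∏ s, qPochHom q (q ^ (m s + 1)) (q * x r / x s) (k r) /
      qPoch q (q * x r / x s) (k r)) = 0 := by
    refine prod_eq_zero (mem_univ r) (prod_eq_zero (mem_univ r) ?_)
    rw [mul_div_assoc, div_self (hx0 r), qPochHom_pow_succ hq, mul_one, qPoch_neg_eq_zero hq hr]
    simp
  rw [outerCoeff, this]
  simp

theorem innerCoeff_eq_zero (hq : q ≠ 0) (hx0 : ∀ r, x r ≠ 0) {k m : Fin n → ℕ} (h : ¬ m ≤ k) :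
    innerCoeff q α x k m = 0 := by
  rw [Pi.le_def] at h
  push Not at h
  obtain ⟨r, hr⟩ := h
  have : (∏ r, ∏ s, qPoch q (q ^ (-(k s : ℤ)) * x r / x s) (m r) /
      qPoch q (q * x r / x s) (m r)) = 0 := by
    refine prod_eq_zero (mem_univ r) (prod_eq_zero (mem_univ r) ?_)
    rw [mul_div_assoc, div_self (hx0 r), mul_one, qPoch_neg_eq_zero hq hr]
    simp
  rw [innerCoeff, this]
  simp

/-- The `A_n` parts of the two coefficients combine to the square in `anFactor_mul_prod_sq`. The
parts with `α` cancel after splitting `(α x_r)_{|K| + K_r + 1}` in two ways. -/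
theorem outerCoeff_mul_innerCoeff_self (hq0 : 0 < ‖q‖) (hq1 : ‖q‖ < 1) (hx0 : ∀ r, x r ≠ 0)
    (hx : ∀ r s, r ≠ s → ∀ j : ℕ, x r * q ^ j ≠ x s) (hα : ∀ r, α * x r ≠ 1) (K : Fin n → ℕ)
    (hK : ∀ r, ∀ j : ℕ, α * x r * q ^ (K r + 1) * q ^ j ≠ 1) :
    outerCoeff q α x (fun s => q ^ (K s + 1)) K * innerCoeff q α x K K =
      ∏ r, qPoch q (α * q * x r) (K r) := by
  have hq : q ≠ 0 := norm_pos_iff.1 hq0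
  have h1 := anFactor_mul_prod_sq hq0 hq1 hx0 hx K
  set W := ∏ r, ∏ s, qPoch q (q ^ (-(K s : ℤ)) * x r / x s) (K r) /
      qPoch q (q * x r / x s) (K r) with hW
  have h2 : (∏ r, ∏ s, qPochHom q (q ^ (K s + 1)) (q * x r / x s) (K r) /
      qPoch q (q * x r / x s) (K r)) =
      W * (q ^ ((∑ r, K r) * ∑ r, K r) * q ^ (n * ∑ r, K r)) := by
    have e : q ^ ((∑ r, K r) * ∑ r, K r) * q ^ (n * ∑ r, K r) =
        ∏ r, ∏ s, q ^ ((K s + 1) * K r) := by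
      simp only [prod_pow_eq_pow_sum]
      rw [← pow_add]
      congr 1
      simp only [← Finset.sum_mul, ← Finset.mul_sum, Finset.sum_add_distrib]
      simp
      ring
    rw [e, hW, ← prod_mul_distrib]
    refine prod_congr rfl fun r _ => ?_
    rw [← prod_mul_distrib]
    refine prod_congr rfl fun s _ => ?_
    rw [mul_div_assoc q, qPochHom_pow_succ hq, ← mul_div_assoc, div_mul_eq_mul_div]
  have h3 : (∏ r, (1 - α * x r * q ^ (K r + ∑ i, K i)) / (1 - α * x r)) *
      (∏ r, qPoch q (α * x r) (∑ i, K i) / qPoch q (α * x r * q ^ (K r + 1)) (∑ i, K i)) *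
      (∏ r, qPoch q (α * x r * q ^ (∑ i, K i)) (K r)) = ∏ r, qPoch q (α * q * x r) (K r) := by
    rw [← prod_mul_distrib, ← prod_mul_distrib]
    refine prod_congr rfl fun r _ => ?_
    have a1 : 1 - α * x r ≠ 0 := sub_ne_zero.2 (hα r).symm
    have a2 := qPoch_ne_zero (hK r) (∑ i, K i)
    have a3 := qPoch_add q (α * x r) (∑ i, K i) (K r)
    have a4 := qPoch_add q (α * x r) ((∑ i, K i) + K r) 1
    have a5 := qPoch_succ' q (α * x r) ((∑ i, K i) + K r)
    have a6 := qPoch_add q (α * x r * q) (K r) (∑ i, K i)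
    have a7 : qPoch q (α * x r * q ^ ((∑ i, K i) + K r)) 1 =
      1 - α * x r * q ^ (K r + ∑ i, K i) := by simp [qPoch, add_comm]
    rw [a7] at a4
    rw [mul_assoc (α * x r) q, ← pow_succ', add_comm (K r)] at a6
    rw [mul_right_comm α q (x r), div_mul_div_comm, div_mul_eq_mul_div,
      div_eq_iff (mul_ne_zero a1 a2)]
    linear_combination (-(1 - α * x r * q ^ (K r + ∑ i, K i))) * a3 - a4 + a5 +
      (1 - α * x r) * a6
  have h4 : q ^ ((∑ r : Fin n, ((r : ℕ) : ℤ) * (K r : ℤ)) - (n : ℤ) * (∑ i, (K i : ℤ))) *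
      q ^ (∑ r : Fin n, ((r : ℕ) + 1) * K r) * q ^ (n * ∑ r, K r) =
      q ^ (∑ r : Fin n, (2 * (r : ℕ) + 1) * K r) := by
    rw [← zpow_natCast, ← zpow_natCast, ← zpow_natCast, ← zpow_add₀ hq, ← zpow_add₀ hq]
    congr 1
    push_cast
    rw [sub_add_eq_add_sub, sub_add_cancel, ← Finset.sum_add_distrib]
    refine Finset.sum_congr rfl fun r _ => ?_
    ring
  rw [outerCoeff, innerCoeff, ← hW, h2, ← h3]
  set P1 := (∏ r, (1 - α * x r * q ^ (K r + ∑ i, K i)) / (1 - α * x r))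
  set P2 := (∏ r, qPoch q (α * x r) (∑ i, K i) / qPoch q (α * x r * q ^ (K r + 1)) (∑ i, K i))
  set P3 := (∏ r, qPoch q (α * x r * q ^ (∑ i, K i)) (K r))
  rw [← h4] at h1
  linear_combination P1 * P2 * P3 * h1

/-- Both sides come from splitting `(z q)_{K - 1 + m}` at `K - 1` and at `m`, `m + k`. The point is
that the quotient is a polynomial in `z q^m` of degree `K - k - 1`, over a constant. -/
theorem qPoch_div_mul_eq {z : ℂ} (hz : ∀ j : ℕ, z * q ^ j ≠ 1) {k K : ℕ} (hkK : k < K) (m : ℕ) :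
    qPoch q (z * q ^ K) m / (qPoch q (z * q) m * qPoch q (z * q ^ (m + 1)) k) =
      (∏ j ∈ range (K - k - 1), (1 - z * q ^ m * q ^ (k + 1 + j))) / qPoch q (z * q) (K - 1) := by
  have hz' : ∀ i j : ℕ, z * q ^ i * q ^ j ≠ 1 := fun i j => by
    rw [mul_assoc, ← pow_add]
    exact hz _
  have n1 := qPoch_ne_zero (hz' 1) m
  have n2 := qPoch_ne_zero (hz' 1) (K - 1)
  have n3 := qPoch_ne_zero (hz' (m + 1)) k
  rw [pow_one] at n1 n2
  obtain ⟨d, rfl⟩ := Nat.exists_eq_add_of_lt hkK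
  have e1 : k + d + 1 - k - 1 = d := by lia
  have e2 : k + d + 1 - 1 = k + d := by lia
  rw [e2] at n2
  rw [e1, e2]
  rw [div_eq_div_iff (mul_ne_zero n1 n3) n2]
  have a1 := qPoch_add q (z * q) (k + d) m
  have a2 := qPoch_add q (z * q) m (k + d)
  have a3 := qPoch_add q (z * q * q ^ m) k d
  have a4 : qPoch q (z * q * q ^ m * q ^ k) d =
      ∏ j ∈ range d, (1 - z * q ^ m * q ^ (k + 1 + j)) := by
    refine prod_congr rfl fun j _ => ?_
    ring
  have a5 : z * q * q ^ (k + d) = z * q ^ (k + d + 1) := by ring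
  have a6 : z * q * q ^ m = z * q ^ (m + 1) := by ring
  rw [a5] at a1
  rw [a4, a6] at a3
  rw [a6, a3] at a2
  rw [add_comm m] at a2
  linear_combination -a1 + a2

open Polynomial in
/-- Off-diagonal orthogonality. -/
theorem sum_innerCoeff_mul_outerCoeff_eq_zero (hq0 : 0 < ‖q‖) (hq1 : ‖q‖ < 1)
    (hx0 : ∀ r, x r ≠ 0) (hx : ∀ r s, r ≠ s → ∀ j : ℕ, x r * q ^ j ≠ x s)
    (hα : ∀ r, ∀ j : ℕ, α * x r * q ^ j ≠ 1) {k K : Fin n → ℕ} (hkK : ∑ i, k i < ∑ i, K i) :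
    ∑ m ∈ Iic K, innerCoeff q α x K m *
      (outerCoeff q α x (fun s => q ^ (m s + 1)) k / ∏ r, qPoch q (α * q * x r) (m r)) = 0 := by
  have hq : q ≠ 0 := norm_pos_iff.1 hq0
  -- At the node `y = x_s q^(m_s)` the polynomial `p1` gives the factors of `outerCoeff` containing
  -- `a_s = q^(m_s + 1)`, scaled by `x_s^|k|`; `p2` gives the quotient of the factorials with `α`.
  -- The degrees add up to at most `|K| - 1`.
  set p1 : ℂ[X] := ∏ r, ∏ j ∈ range (k r), (C q * X + C (-(q * x r * q ^ j))) with hp1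
  set p2 : ℂ[X] := ∏ j ∈ range ((∑ i, K i) - (∑ i, k i) - 1),
    (C (-(α * q ^ ((∑ i, k i) + 1 + j))) * X + C 1) with hp2
  have hd1 : p1.natDegree ≤ ∑ i, k i := by
    refine (natDegree_prod_le _ _).trans (Finset.sum_le_sum fun r _ => ?_)
    refine (natDegree_prod_le _ _).trans ?_
    refine (Finset.sum_le_card_nsmul _ _ 1 fun j _ => natDegree_linear_le).trans ?_
    simp
  have hd2 : p2.natDegree ≤ (∑ i, K i) - (∑ i, k i) - 1 := by
    refine (natDegree_prod_le _ _).trans ?_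
    refine (Finset.sum_le_card_nsmul _ _ 1 fun j _ => natDegree_linear_le).trans ?_
    simp
  have hdeg : (p1 * p2).natDegree < ∑ i, K i := by
    have := natDegree_mul_le (p := p1) (q := p2)
    lia
  have key := sum_Iic_vandermonde_mul_eval_div_eq_zero K (fun r j => x r * q ^ j)
    (injective_node hq0 hq1 hx0 hx).injOn hdeg
  -- `Q` and `c` collect everything that does not depend on `m`.
  set Q : ℂ := anFactor q x k * (∏ r, ∏ s, (qPoch q (q * x r / x s) (k r))⁻¹) *
    (∏ r, (1 - α * x r * q ^ (k r + ∑ i, k i)) / (1 - α * x r)) *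
    (∏ r, qPoch q (α * x r) (∑ i, k i)) *
    q ^ ((∑ r : Fin n, ((r : ℕ) : ℤ) * (k r : ℤ)) - (n : ℤ) * (∑ i, (k i : ℤ))) with hQ
  set c : Fin n → ℂ := fun r => nodeProd q x K r 0 / (x r ^ (∑ i, k i) *
    qPoch q (α * q * x r) ((∑ i, K i) - 1)) with hc
  rw [← mul_zero (Q * (∏ r, c r) / ∏ r, ∏ s ∈ Ioi r, (x s - x r)), ← key, Finset.mul_sum]
  refine Finset.sum_congr rfl fun m hm => ?_
  rw [mem_Iic] at hm
  have hV := anFactor_mul_pow hq0 hx0 hx m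
  have hpow : q ^ (∑ r : Fin n, ((r : ℕ) + 1) * m r) =
      q ^ (∑ r : Fin n, (r : ℕ) * m r) * ∏ r, q ^ m r := by
    rw [prod_pow_eq_pow_sum, ← pow_add, ← Finset.sum_add_distrib]
    simp only [add_mul, one_mul]
  have hinner : innerCoeff q α x K m = ((∏ r, ∏ s ∈ Ioi r, (x s * q ^ m s - x r * q ^ m r)) /
        ∏ r, ∏ s ∈ Ioi r, (x s - x r)) * ∏ r, (nodeProd q x K r 0 / nodeProd q x K r (m r) *
        qPoch q (α * x r * q ^ (∑ i, K i)) (m r)) := by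
    rw [← hV, innerCoeff, hpow, prod_mul_distrib]
    have : ∏ r, (nodeProd q x K r 0 / nodeProd q x K r (m r)) = (∏ r, q ^ m r) *
        (∏ r, ∏ s, qPoch q (q ^ (-(K s : ℤ)) * x r / x s) (m r) /
          qPoch q (q * x r / x s) (m r)) := by
      rw [← prod_mul_distrib]
      refine prod_congr rfl fun r _ => ?_
      rw [← nodeProd_mul_weight hq0 hq1 hx0 hx K r (hm r),
        mul_div_cancel_left₀ _ (nodeProd_ne_zero hq0 hq1 hx0 hx K r _)]
    rw [this]
    ring
  have houter : outerCoeff q α x (fun s => q ^ (m s + 1)) k =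
      Q * ∏ r, (p1.eval (x r * q ^ m r) / x r ^ (∑ i, k i) /
        qPoch q (α * x r * q ^ (m r + 1)) (∑ i, k i)) := by
    have e1 : (∏ r, ∏ s, qPochHom q (q ^ (m s + 1)) (q * x r / x s) (k r) /
        qPoch q (q * x r / x s) (k r)) =
        (∏ r, ∏ s, (qPoch q (q * x r / x s) (k r))⁻¹) *
        ∏ r, p1.eval (x r * q ^ m r) / x r ^ (∑ i, k i) := by
      simp only [div_eq_mul_inv _ (qPoch _ _ _), prod_mul_distrib]
      rw [mul_comm, prod_comm (f := fun r s => qPochHom q (q ^ (m s + 1)) (q * x r / x s) (k r))]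
      congr 1
      refine prod_congr rfl fun s _ => ?_
      rw [← prod_pow_eq_pow_sum, hp1, eval_prod, ← prod_div_distrib]
      refine prod_congr rfl fun r _ => ?_
      rw [eval_prod, qPochHom, ← card_range (k r), ← prod_const, card_range, ← prod_div_distrib]
      refine prod_congr rfl fun j _ => ?_
      have := hx0 s
      simp
      field_simp
      ring
    rw [outerCoeff, e1, prod_div_distrib
      (f := fun r => qPoch q (α * x r) (∑ i, k i)), prod_div_distrib
      (f := fun r => p1.eval (x r * q ^ m r) / x r ^ (∑ i, k i)), hQ]
    ring
  have hfac : ∀ r, nodeProd q x K r 0 / nodeProd q x K r (m r) *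
        qPoch q (α * x r * q ^ (∑ i, K i)) (m r) *
      (p1.eval (x r * q ^ m r) / x r ^ (∑ i, k i) /
        qPoch q (α * x r * q ^ (m r + 1)) (∑ i, k i)) / qPoch q (α * q * x r) (m r) =
      c r * ((p1 * p2).eval (x r * q ^ m r) / nodeProd q x K r (m r)) := by
    intro r
    have h := qPoch_div_mul_eq (hα r) hkK (m r)
    have h2 : p2.eval (x r * q ^ m r) = ∏ j ∈ range ((∑ i, K i) - (∑ i, k i) - 1),
        (1 - α * x r * q ^ m r * q ^ ((∑ i, k i) + 1 + j)) := by
      rw [hp2, eval_prod]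
      refine prod_congr rfl fun j _ => ?_
      simp
      ring
    rw [← h2, mul_right_comm α (x r) q] at h
    rw [eval_mul, hc]
    calc _ = nodeProd q x K r 0 / nodeProd q x K r (m r) * (p1.eval (x r * q ^ m r) /
        x r ^ (∑ i, k i)) * (qPoch q (α * x r * q ^ (∑ i, K i)) (m r) /
          (qPoch q (α * q * x r) (m r) * qPoch q (α * x r * q ^ (m r + 1)) (∑ i, k i))) := by
          ring
      _ = _ := by rw [h]; ring
  have hprod := prod_congr (rfl : (univ : Finset (Fin n)) = univ) fun r _ => hfac r
  rw [prod_div_distrib, prod_mul_distrib, prod_mul_distrib (f := c)] at hprod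
  rw [hinner, houter]
  simp only [nodeProd] at hprod ⊢
  linear_combination (Q / ∏ r, ∏ s ∈ Ioi r, (x s - x r)) *
    (∏ r, ∏ s ∈ Ioi r, (x s * q ^ m s - x r * q ^ m r)) * hprod

theorem sum_innerCoeff_mul_outerCoeff (hq0 : 0 < ‖q‖) (hq1 : ‖q‖ < 1)
    (hx0 : ∀ r, x r ≠ 0) (hx : ∀ r s, r ≠ s → ∀ j : ℕ, x r * q ^ j ≠ x s)
    (hα : ∀ r, ∀ j : ℕ, α * x r * q ^ j ≠ 1) {M K : Fin n → ℕ} (hKM : K ≤ M) (k : Fin n → ℕ) :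
    ∑ m ∈ Iic M, innerCoeff q α x K m *
      (outerCoeff q α x (fun s => q ^ (m s + 1)) k / ∏ r, qPoch q (α * q * x r) (m r)) =
      if K = k then 1 else 0 := by
  have hq : q ≠ 0 := norm_pos_iff.1 hq0
  have hα' : ∀ r, ∀ i j : ℕ, α * x r * q ^ i * q ^ j ≠ 1 := fun r i j => by
    rw [mul_assoc, ← pow_add]
    exact hα r _
  have hsub : Iic K ⊆ Iic M := Iic_subset_Iic.2 hKM
  rw [← Finset.sum_subset hsub fun m _ hm => by
    rw [innerCoeff_eq_zero hq hx0 (by simpa using hm), zero_mul]]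
  split_ifs with h
  · subst h
    rw [Finset.sum_eq_single_of_mem K (mem_Iic.2 le_rfl)]
    · rw [mul_div_assoc', mul_comm, outerCoeff_mul_innerCoeff_self hq0 hq1 hx0 hx
        (fun r => by simpa using hα r 0) K (fun r j => hα' r _ _), div_self]
      refine prod_ne_zero_iff.2 fun r _ => qPoch_ne_zero (fun j => ?_) _
      have := hα' r 1 j
      rwa [pow_one, mul_right_comm α] at this
    · intro m hm hmK
      rw [outerCoeff_eq_zero hq hx0 fun hKm => hmK (le_antisymm (mem_Iic.1 hm) hKm)]
      simp
  · by_cases hk : k ≤ K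
    · refine sum_innerCoeff_mul_outerCoeff_eq_zero hq0 hq1 hx0 hx hα ?_
      -- Triangularity leaves only `k ≤ K` with `k ≠ K`, so that `|k| < |K|`.
      obtain ⟨r, hr⟩ : ∃ r, k r < K r := by
        by_contra hcon
        push Not at hcon
        exact h (le_antisymm hcon hk)
      exact Finset.sum_lt_sum (fun i _ => hk i) ⟨r, mem_univ r, hr⟩
    · refine Finset.sum_eq_zero fun m hm => ?_
      rw [outerCoeff_eq_zero hq hx0 fun hkm => hk (hkm.trans (mem_Iic.1 hm))]
      simp

theorem sum_outerCoeff_mul_innerCoeff (hq0 : 0 < ‖q‖) (hq1 : ‖q‖ < 1)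
    (hx0 : ∀ r, x r ≠ 0) (hx : ∀ r s, r ≠ s → ∀ j : ℕ, x r * q ^ j ≠ x s)
    (hα : ∀ r, ∀ j : ℕ, α * x r * q ^ j ≠ 1) {M m : Fin n → ℕ} (hm : m ≤ M) :
    ∑ k ∈ Iic M, outerCoeff q α x (fun s => q ^ (M s + 1)) k * innerCoeff q α x k m =
      if M = m then ∏ r, qPoch q (α * q * x r) (M r) else 0 := by
  -- Over the box `Iic M` the matrices are square and finite, so `B * A = 1` gives `A * B = 1`,
  -- whose row `M` is the claim.
  let A : Matrix (Iic M) (Iic M) ℂ := .of fun m k =>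
    outerCoeff q α x (fun s => q ^ (m.1 s + 1)) k.1 / ∏ r, qPoch q (α * q * x r) (m.1 r)
  let B : Matrix (Iic M) (Iic M) ℂ := .of fun k m => innerCoeff q α x k.1 m.1
  have hBA : B * A = 1 := by
    ext K k
    rw [Matrix.mul_apply, Matrix.one_apply]
    have h := sum_innerCoeff_mul_outerCoeff hq0 hq1 hx0 hx hα (mem_Iic.1 K.2) k.1
    rw [← Finset.sum_coe_sort (Iic M)] at h
    simp only [A, B, Matrix.of_apply, h, Subtype.ext_iff]
  have hAB := mul_eq_one_comm.1 hBA
  have h := congrFun (congrFun hAB ⟨M, mem_Iic.2 le_rfl⟩) ⟨m, mem_Iic.2 hm⟩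
  rw [Matrix.mul_apply, Matrix.one_apply] at h
  simp only [A, B, Matrix.of_apply, Subtype.mk.injEq] at h
  rw [Finset.sum_coe_sort (Iic M) (fun k => outerCoeff q α x (fun s => q ^ (M s + 1)) k /
    (∏ r, qPoch q (α * q * x r) (M r)) * innerCoeff q α x k m)] at h
  have hne : ∏ r, qPoch q (α * q * x r) (M r) ≠ 0 := by
    refine prod_ne_zero_iff.2 fun r _ => qPoch_ne_zero (fun j => ?_) _
    have := hα r (j + 1)
    rwa [pow_succ', ← mul_assoc, mul_right_comm α] at this
  simp only [div_mul_eq_mul_div] at h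
  rw [← Finset.sum_div, div_eq_iff hne] at h
  rw [h]
  split_ifs <;> simp

theorem sum_outerCoeff_mul_sum_innerCoeff_of_generic (hq0 : 0 < ‖q‖) (hq1 : ‖q‖ < 1)
    (hx0 : ∀ r, x r ≠ 0) (hx : ∀ r s, r ≠ s → ∀ j : ℕ, x r * q ^ j ≠ x s)
    (hα : ∀ r, ∀ j : ℕ, α * x r * q ^ j ≠ 1) (M : Fin n → ℕ) (G : (Fin n → ℕ) → ℂ) :
    ∑ k ∈ Iic M, outerCoeff q α x (fun s => q ^ (M s + 1)) k *
      ∑ m ∈ Iic k, innerCoeff q α x k m * G m =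
      G M * ∏ r, qPoch q (α * q * x r) (M r) := by
  have hq : q ≠ 0 := norm_pos_iff.1 hq0
  have e : ∀ k ∈ Iic M, outerCoeff q α x (fun s => q ^ (M s + 1)) k *
      ∑ m ∈ Iic k, innerCoeff q α x k m * G m =
      ∑ m ∈ Iic M, outerCoeff q α x (fun s => q ^ (M s + 1)) k * innerCoeff q α x k m * G m := by
    intro k hk
    rw [Finset.sum_subset (Iic_subset_Iic.2 (mem_Iic.1 hk)) fun m _ hm => by
      rw [innerCoeff_eq_zero hq hx0 (by simpa using hm), zero_mul], Finset.mul_sum]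
    simp only [mul_assoc]
  rw [Finset.sum_congr rfl e, Finset.sum_comm]
  simp only [← Finset.sum_mul]
  rw [Finset.sum_congr rfl fun m hm => by
    rw [sum_outerCoeff_mul_innerCoeff hq0 hq1 hx0 hx hα (mem_Iic.1 hm)]]
  rw [Finset.sum_eq_single_of_mem M (mem_Iic.2 le_rfl) fun m _ hm => by
    rw [if_neg (Ne.symm hm), zero_mul], if_pos rfl, mul_comm]

open Filter Topology in
-- The identity itself has only the denominators `1 - α x_r` and factors of `(α x_r q^(M_r +
-- 1))_{|k|}`, so the remaining genericity conditions on `α` can be dropped by continuity.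
theorem sum_outerCoeff_mul_sum_innerCoeff (hq0 : 0 < ‖q‖) (hq1 : ‖q‖ < 1)
    (hx0 : ∀ r, x r ≠ 0) (hx : ∀ r s, r ≠ s → ∀ j : ℕ, x r * q ^ j ≠ x s)
    (hα : ∀ r, α * x r ≠ 1) (M : Fin n → ℕ)
    (hM : ∀ r, ∀ j : ℕ, α * x r * q ^ (M r + 1) * q ^ j ≠ 1) (G : (Fin n → ℕ) → ℂ) :
    ∑ k ∈ Iic M, outerCoeff q α x (fun s => q ^ (M s + 1)) k *
      ∑ m ∈ Iic k, innerCoeff q α x k m * G m =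
      G M * ∏ r, qPoch q (α * q * x r) (M r) := by
  have hq : q ≠ 0 := norm_pos_iff.1 hq0
  -- The excluded values of `α` form a countable set, whose complement is dense.
  set bad : Set ℂ := ⋃ r : Fin n, ⋃ j : ℕ, {(x r * q ^ j)⁻¹} with hbad
  have hcount : bad.Countable :=
    Set.countable_iUnion fun r => Set.countable_iUnion fun j => Set.countable_singleton _
  have hdense : Dense badᶜ := hcount.dense_compl ℂ
  have hne : NeBot (𝓝[badᶜ] α) := mem_closure_iff_nhdsWithin_neBot.1 (hdense α)
  have hcont : ContinuousAt (fun β => ∑ k ∈ Iic M, outerCoeff q β x (fun s => q ^ (M s + 1)) k *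
      ∑ m ∈ Iic k, innerCoeff q β x k m * G m) α := by
    refine tendsto_finsetSum _ fun k _ => Tendsto.mul ?_ ?_
    · unfold outerCoeff
      refine ContinuousAt.mul (ContinuousAt.mul (ContinuousAt.mul continuousAt_const ?_) ?_)
        continuousAt_const
      · refine tendsto_finsetProd _ fun r _ => ContinuousAt.div (by fun_prop) (by fun_prop) ?_
        exact sub_ne_zero.2 (hα r).symm
      · refine tendsto_finsetProd _ fun r _ => ContinuousAt.div ?_ ?_ ?_
        · unfold qPoch; fun_prop
        · unfold qPoch; fun_prop
        · exact qPoch_ne_zero (hM r) _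
    · refine Continuous.tendsto ?_ α
      unfold innerCoeff qPoch
      fun_prop
  have hcont2 : ContinuousAt (fun β => G M * ∏ r, qPoch q (β * q * x r) (M r)) α := by
    unfold qPoch
    fun_prop
  refine tendsto_nhds_unique (l := 𝓝[badᶜ] α) (hcont.tendsto.mono_left nhdsWithin_le_nhds)
    ((hcont2.tendsto.mono_left nhdsWithin_le_nhds).congr' ?_)
  filter_upwards [self_mem_nhdsWithin] with β hβ
  refine (sum_outerCoeff_mul_sum_innerCoeff_of_generic hq0 hq1 hx0 hx (fun r j h => hβ ?_) M G).symm
  simp only [hbad, Set.mem_iUnion, Set.mem_singleton_iff]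
  exact ⟨r, j, eq_inv_of_mul_eq_one_left (by rw [← mul_assoc]; exact h)⟩

end Inversion

/-! ### The expansion at the points `a_r = q^(M_r + 1)` -/

section Terminating

variable {n : ℕ} {q α b : ℂ} {x : Fin n → ℂ}

theorem outerTermExt_eq_zero (hq : q ≠ 0) (hx0 : ∀ r, x r ≠ 0) (F : (Fin n → ℕ) → ℂ)
    {k M : Fin n → ℕ} (h : ¬ k ≤ M) :
    outerTermExt q α b x (fun s => q ^ (M s + 1)) F k = 0 := by
  change outerCoeff q α x (fun s => q ^ (M s + 1)) k * innerSum q α b x F k = 0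
  rw [outerCoeff_eq_zero hq hx0 h, zero_mul]

theorem infFactor_qpow (hq0 : 0 < ‖q‖) (hq1 : ‖q‖ < 1)
    (hb : ∀ r, ∀ j : ℕ, α * b * x r * q ^ j ≠ 1) (M : Fin n → ℕ)
    (hM : ∀ r, ∀ j : ℕ, α * x r * q ^ (M r + 1) * q ^ j ≠ 1) :
    infFactor q α b x (fun s => q ^ (M s + 1)) =
      (∏ r, qPoch q (α * q * x r) (M r)) / ∏ r, qPoch q (α * b * x r) (M r) := by
  have hq : q ≠ 0 := norm_pos_iff.1 hq0
  rw [infFactor, ← prod_div_distrib]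
  refine prod_congr rfl fun r _ => ?_
  have e1 : α * q ^ (M r + 1) * x r = α * q * x r * q ^ M r := by ring
  have e2 : α * q ^ (M r + 1) * b * x r / q = α * b * x r * q ^ M r := by
    field_simp
    ring
  -- The tails common to numerator and denominator must be nonzero in order to cancel.
  have n1 : qPochInf q (α * q * x r * q ^ M r) ≠ 0 := qPochInf_ne_zero hq1 fun j => by
    have := hM r j
    rwa [mul_right_comm α, e1] at this
  have n2 : qPochInf q (α * b * x r * q ^ M r) ≠ 0 := qPochInf_ne_zero hq1 fun j => by
    rw [mul_assoc, ← pow_add]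
    exact hb r _
  have n3 := qPoch_ne_zero (hb r) (M r)
  rw [e1, e2, qPochInf_eq_mul hq1 (α * q * x r) (M r), qPochInf_eq_mul hq1 (α * b * x r) (M r)]
  generalize qPochInf q (α * q * x r * q ^ M r) = u at n1 ⊢
  generalize qPochInf q (α * b * x r * q ^ M r) = v at n2 ⊢
  generalize qPoch q (α * b * x r) (M r) = w at n3 ⊢
  field_simp

theorem hasSum_outerTermExt_qpow (hq0 : 0 < ‖q‖) (hq1 : ‖q‖ < 1)
    (hx0 : ∀ r, x r ≠ 0) (hx : ∀ r s, r ≠ s → ∀ j : ℕ, x r * q ^ j ≠ x s)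
    (hα : ∀ r, α * x r ≠ 1) (hb : ∀ r, ∀ j : ℕ, α * b * x r * q ^ j ≠ 1) (M : Fin n → ℕ)
    (hM : ∀ r, ∀ j : ℕ, α * q ^ (M r + 1) * x r * q ^ j ≠ 1) (F : (Fin n → ℕ) → ℂ) :
    HasSum (outerTermExt q α b x (fun s => q ^ (M s + 1)) F)
      (F M * infFactor q α b x (fun s => q ^ (M s + 1))) := by
  have hq : q ≠ 0 := norm_pos_iff.1 hq0
  have hM' : ∀ r, ∀ j : ℕ, α * x r * q ^ (M r + 1) * q ^ j ≠ 1 := fun r j => by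
    rw [mul_right_comm α]
    exact hM r j
  have h := sum_outerCoeff_mul_sum_innerCoeff hq0 hq1 hx0 hx hα M hM'
    fun m => F m / ∏ r, qPoch q (α * b * x r) (m r)
  simp only [← innerSum_eq] at h
  rw [infFactor_qpow hq0 hq1 hb M hM', mul_div_assoc', mul_div_right_comm, ← h]
  exact hasSum_sum_of_ne_finset_zero fun k hk =>
    outerTermExt_eq_zero hq hx0 F (by simpa using hk)

end Terminating

/-! ### Identity theorem on a polydisc -/

section Analytic

open Filter Topology

/-- An analytic function on a polydisc that vanishes at all points `(q ^ N_1, …, q ^ N_n)` of the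
polydisc vanishes identically. -/
theorem eq_zero_on_polydisc_of_eq_zero_qpow {n : ℕ} {q : ℂ} (hq0 : 0 < ‖q‖) (hq1 : ‖q‖ < 1)
    {R : Fin n → ℝ} (hR : ∀ r, 0 < R r) {H : (Fin n → ℂ) → ℂ}
    (hH : AnalyticOnNhd ℂ H (polydisc R))
    (h0 : ∀ M : Fin n → ℕ, (fun r => q ^ (M r + 1)) ∈ polydisc R → H (fun r => q ^ (M r + 1)) = 0) :
    ∀ a ∈ polydisc R, H a = 0 := by
  have hq : q ≠ 0 := norm_pos_iff.1 hq0
  -- Induction on the set `s` of coordinates that are free; the others are still restricted to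
  -- powers of `q`.
  have key : ∀ s : Finset (Fin n), ∀ a ∈ polydisc R, (∀ r, r ∉ s → ∃ N, a r = q ^ (N + 1)) →
      H a = 0 := by
    intro s
    induction s using Finset.induction_on with
    | empty =>
      intro a ha hN
      choose N hN using fun r => hN r (Finset.notMem_empty r)
      obtain rfl : a = fun r => q ^ (N r + 1) := funext hN
      exact h0 N ha
    | insert i s _ ih =>
      intro a ha hN
      have hmem : ∀ z ∈ Metric.ball (0 : ℂ) (R i), Function.update a i z ∈ polydisc R := by
        intro z hz r
        by_cases hr : r = i
        · subst hr
          simpa using hz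
        · rw [Function.update_of_ne hr]
          exact ha r
      have hupd : ∀ z : ℂ, AnalyticAt ℂ (fun z => Function.update a i z) z := by
        intro z
        rw [analyticAt_pi_iff]
        intro r
        by_cases hr : r = i
        · subst hr
          simp only [Function.update_self]
          exact analyticAt_id
        · simpa [Function.update_of_ne hr] using analyticAt_const
      have hg : AnalyticOnNhd ℂ (fun z => H (Function.update a i z)) (Metric.ball 0 (R i)) :=
        fun z hz => AnalyticAt.fun_comp (hH _ (hmem z hz)) (hupd z)
      have htend : Tendsto (fun N : ℕ => q ^ (N + 1)) atTop (𝓝[≠] 0) := by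
        refine tendsto_nhdsWithin_iff.2 ⟨?_, Eventually.of_forall fun N => pow_ne_zero _ hq⟩
        exact (tendsto_pow_atTop_nhds_zero_of_norm_lt_one hq1).comp (tendsto_add_atTop_nat 1)
      have hev : ∀ᶠ N : ℕ in atTop, q ^ (N + 1) ∈ Metric.ball (0 : ℂ) (R i) :=
        (htend.mono_right nhdsWithin_le_nhds).eventually (Metric.ball_mem_nhds 0 (hR i))
      -- With coordinate `i` set to `q^(N + 1)` the induction hypothesis applies, and these nonzero
      -- points tend to `0`, an interior point of the disc.
      have hfreq : ∃ᶠ z in 𝓝[≠] (0 : ℂ), H (Function.update a i z) = 0 := by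
        refine htend.frequently (Eventually.frequently (hev.mono fun N hz => ?_))
        refine ih _ (hmem _ hz) fun r hr => ?_
        by_cases hri : r = i
        · subst hri
          exact ⟨N, by simp⟩
        · rw [Function.update_of_ne hri]
          exact hN r (by simp [hri, hr])
      have := hg.eqOn_zero_of_preconnected_of_frequently_eq_zero
        (convex_ball 0 (R i)).isPreconnected (Metric.mem_ball_self (hR i)) hfreq
        (x := a i) (by simpa using ha i)
      simpa using this
  exact fun a ha => key univ a ha fun r hr => absurd (mem_univ r) hr

end Analytic

/-! ### Both forms of the expansion for a general interpolating function -/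

section Expansion

variable {n : ℕ} {q α b : ℂ} {x : Fin n → ℂ}

/-- The expansion on a polydisc, for a left side `g a * P(a)` with `g` interpolating `F`. -/
theorem hasSum_outerTermExt_of_analytic (hq0 : 0 < ‖q‖) (hq1 : ‖q‖ < 1)
    (hx0 : ∀ r, x r ≠ 0) (hx : ∀ r s, r ≠ s → ∀ j : ℕ, x r * q ^ j ≠ x s)
    (hα : ∀ r, α * x r ≠ 1) (hb : ∀ r, ∀ j : ℕ, α * b * x r * q ^ j ≠ 1)
    (g : (Fin n → ℂ) → ℂ) (F : (Fin n → ℕ) → ℂ) (hgF : ∀ M, g (fun r => q ^ (M r + 1)) = F M)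
    {R : Fin n → ℝ} (hR : ∀ r, 0 < R r)
    (hD : ∀ a ∈ polydisc R, ∀ r, ∀ j : ℕ, α * a r * x r * q ^ j ≠ 1)
    (h : BothSidesAnalytic (polydisc R) (fun a => g a * infFactor q α b x a)
      (fun a => outerTermExt q α b x a F)) :
    ∀ a ∈ polydisc R, HasSum (outerTermExt q α b x a F) (g a * infFactor q α b x a) := by
  obtain ⟨hG, hsum, hT⟩ := h
  -- The difference of the two sides is analytic and vanishes at all points `q^(M_r + 1)` in the
  -- polydisc by the terminating case.
  have h0 := eq_zero_on_polydisc_of_eq_zero_qpow hq0 hq1 hR (hG.sub hT) fun M hM => by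
    have := hasSum_outerTermExt_qpow hq0 hq1 hx0 hx hα hb M (hD _ hM) F
    rw [Pi.sub_apply, sub_eq_zero, hgF, this.tsum_eq]
  intro a ha
  have e : g a * infFactor q α b x a = ∑' k, outerTermExt q α b x a F k := sub_eq_zero.1 (h0 a ha)
  rw [e]
  exact (hsum a ha).of_norm.hasSum

/-- The terminating expansion. -/
theorem outerTerm_eq_zero_and_hasSum (hq0 : 0 < ‖q‖) (hq1 : ‖q‖ < 1)
    (hx0 : ∀ r, x r ≠ 0) (hx : ∀ r s, r ≠ s → ∀ j : ℕ, x r * q ^ j ≠ x s)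
    (hα : ∀ r, α * x r ≠ 1) (hb : ∀ r, ∀ j : ℕ, α * b * x r * q ^ j ≠ 1)
    (g : (Fin n → ℂ) → ℂ) (F : (Fin n → ℕ) → ℂ) (hgF : ∀ M, g (fun r => q ^ (M r + 1)) = F M)
    (N : Fin n → ℕ) (a : Fin n → ℂ) (hN : ∀ r, 1 ≤ N r) (ha : ∀ r, a r = q ^ N r)
    (hD : ∀ r, ∀ j : ℕ, α * a r * x r * q ^ j ≠ 1) :
    (∀ k : Fin n → ℕ, (∃ r, N r ≤ k r) → outerTerm q α b x a F k = 0) ∧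
      HasSum (outerTerm q α b x a F) (g a * infFactor q α b x a) := by
  have hq : q ≠ 0 := norm_pos_iff.1 hq0
  obtain ⟨M, rfl⟩ : ∃ M : Fin n → ℕ, N = fun r => M r + 1 :=
    ⟨fun r => N r - 1, funext fun r => (Nat.sub_add_cancel (hN r)).symm⟩
  obtain rfl : a = fun r => q ^ (M r + 1) := funext ha
  have e := fun k => outerTermExt_eq_outerTerm q α b x (fun r => q ^ (M r + 1)) F k
    fun r => pow_ne_zero _ hq
  rw [← funext e]
  constructor
  · rintro k ⟨r, hr⟩
    exact outerTermExt_eq_zero hq hx0 F fun hk => absurd (hk r) (Nat.not_le.2 hr)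
  · rw [hgF]
    exact hasSum_outerTermExt_qpow hq0 hq1 hx0 hx hα hb M hD F

/-- The factor `q^(1 - n)` in the argument of `f` compensates the shifts `M_r + 1`, leaving the
exponent `1 + |M|`. -/
theorem mul_prod_qpow_mul_zpow (hq : q ≠ 0) (M : Fin n → ℕ) :
    α * (∏ r, q ^ (M r + 1)) * q ^ (1 - (n : ℤ)) = α * q ^ (1 + ∑ r, M r) := by
  rw [prod_pow_eq_pow_sum, Finset.sum_add_distrib, mul_assoc, ← zpow_natCast, ← zpow_natCast,
    ← zpow_add₀ hq]
  congr 2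
  push_cast
  simp
  ring

end Expansion

end

theorem mainTheorem3 (n : ℕ) (q α b : ℂ) (x : Fin n → ℂ)
    (hq0 : 0 < ‖q‖) (hq1 : ‖q‖ < 1)
    (hx0 : ∀ r, x r ≠ 0)
    (hx : ∀ r s, r ≠ s → ∀ j : ℕ, x r * q ^ j ≠ x s)
    (hα : ∀ r, α * x r ≠ 1)
    (hb : ∀ r, ∀ j : ℕ, α * b * x r * q ^ j ≠ 1) :
    -- functions `f` of one variable
    (∀ f : ℂ → ℂ,
      -- both sides analytic on a polydisc
      (∀ R : Fin n → ℝ, (∀ r, 0 < R r) →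
        (∀ a ∈ polydisc R, ∀ r, ∀ j : ℕ, α * a r * x r * q ^ j ≠ 1) →
        BothSidesAnalytic (polydisc R)
          (fun a => f (α * (∏ r, a r) * q ^ (1 - (n : ℤ))) * infFactor q α b x a)
          (fun a => outerTermExt q α b x a (fun m => f (α * q ^ (1 + ∑ r, m r)))) →
        ∀ a ∈ polydisc R,
          HasSum (outerTermExt q α b x a (fun m => f (α * q ^ (1 + ∑ r, m r))))
            (f (α * (∏ r, a r) * q ^ (1 - (n : ℤ))) * infFactor q α b x a)) ∧
      -- terminating series
      (∀ (N : Fin n → ℕ) (a : Fin n → ℂ), (∀ r, 1 ≤ N r) → (∀ r, a r = q ^ N r) →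
        (∀ r, ∀ j : ℕ, α * a r * x r * q ^ j ≠ 1) →
        (∀ k : Fin n → ℕ, (∃ r, N r ≤ k r) →
          outerTerm q α b x a (fun m => f (α * q ^ (1 + ∑ r, m r))) k = 0) ∧
        HasSum (outerTerm q α b x a (fun m => f (α * q ^ (1 + ∑ r, m r))))
          (f (α * (∏ r, a r) * q ^ (1 - (n : ℤ))) * infFactor q α b x a))) ∧
    -- functions `f` of `n` variables
    (∀ f : (Fin n → ℂ) → ℂ,
      -- both sides analytic on a polydisc
      (∀ R : Fin n → ℝ, (∀ r, 0 < R r) →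
        (∀ a ∈ polydisc R, ∀ r, ∀ j : ℕ, α * a r * x r * q ^ j ≠ 1) →
        BothSidesAnalytic (polydisc R)
          (fun a => f (fun r => α * a r) * infFactor q α b x a)
          (fun a => outerTermExt q α b x a (fun m => f (fun r => α * q ^ (1 + m r)))) →
        ∀ a ∈ polydisc R,
          HasSum (outerTermExt q α b x a (fun m => f (fun r => α * q ^ (1 + m r))))
            (f (fun r => α * a r) * infFactor q α b x a)) ∧
      -- terminating series
      (∀ (N : Fin n → ℕ) (a : Fin n → ℂ), (∀ r, 1 ≤ N r) → (∀ r, a r = q ^ N r) →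
        (∀ r, ∀ j : ℕ, α * a r * x r * q ^ j ≠ 1) →
        (∀ k : Fin n → ℕ, (∃ r, N r ≤ k r) →
          outerTerm q α b x a (fun m => f (fun r => α * q ^ (1 + m r))) k = 0) ∧
        HasSum (outerTerm q α b x a (fun m => f (fun r => α * q ^ (1 + m r))))
          (f (fun r => α * a r) * infFactor q α b x a))) := by
  have hq : q ≠ 0 := norm_pos_iff.1 hq0
  have h1 : ∀ f : ℂ → ℂ, ∀ M : Fin n → ℕ,
      f (α * (∏ r, q ^ (M r + 1)) * q ^ (1 - (n : ℤ))) = f (α * q ^ (1 + ∑ r, M r)) :=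
    fun f M => by rw [mul_prod_qpow_mul_zpow hq]
  have h2 : ∀ f : (Fin n → ℂ) → ℂ, ∀ M : Fin n → ℕ,
      f (fun r => α * q ^ (M r + 1)) = f (fun r => α * q ^ (1 + M r)) :=
    fun f M => by simp only [add_comm]
  refine ⟨fun f => ⟨fun R hR hD h => ?_, fun N a hN ha hD => ?_⟩,
    fun f => ⟨fun R hR hD h => ?_, fun N a hN ha hD => ?_⟩⟩
  · exact hasSum_outerTermExt_of_analytic hq0 hq1 hx0 hx hα hb
      (fun a => f (α * (∏ r, a r) * q ^ (1 - (n : ℤ)))) _ (h1 f) hR hD h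
  · exact outerTerm_eq_zero_and_hasSum hq0 hq1 hx0 hx hα hb
      (fun a => f (α * (∏ r, a r) * q ^ (1 - (n : ℤ)))) _ (h1 f) N a hN ha hD
  · exact hasSum_outerTermExt_of_analytic hq0 hq1 hx0 hx hα hb
      (fun a => f (fun r => α * a r)) _ (h2 f) hR hD h
  · exact outerTerm_eq_zero_and_hasSum hq0 hq1 hx0 hx hα hb
      (fun a => f (fun r => α * a r)) _ (h2 f) N a hN ha hD
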